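/- Let $G$ be a locally compact, $\sigma$-compact (Hausdorff) group with left Haar measure $m$. A (left) Følner sequence is a sequence $\mathcal F=(F_n)_{n\in\mathbb N}$ of compact subsets of $G$ with $m(F_n)>0$ and $$\lim_{n\to\infty}\frac{m(gF_n\,\triangle\,F_n)}{m(F_n)}=0\qquad\text{for all } g\in G;$$ assume that $G$ is amenable, that is, that such a sequence exists. Let $G$ act on a compact metric space $(X,d)$ such that $G\times X\to X$, $(g,x)\mapsto gx$, is continuous. For $x,y\in X$ put $$D(x,y)=\sup_{\mathcal F}\ \limsup_{n\to\infty}\frac1{m(F_n)}\int_{F_n}d(tx,ty)\,dm(t),$$ where the supremum is over all Følner sequences $\mathcal F=(F_n)$ in $G$. The system $(X,G)$ is called Weyl-mean equicontinuous if for every $\varepsilon>0$ there is $\delta>0$ such that $d(x,y)<\delta$ implies $D(x,y)<\varepsilon$ for all $x,y\in X$. A factor map between two continuous $G$-actions on compact metric spaces is a continuous $G$-equivariant surjection. A system $(Y,G)$ is equicontinuous if for every $\varepsilon>0$ there is $\delta>0$ such that $d(x,y)<\delta$ implies $d(gx,gy)<\varepsilon$ for all $g\in G$. Let $\pi:X\to\mathbb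 T$ be the factor map onto the maximal equicontinuous factor $(\mathbb T,G)$ of $(X,G)$; that is, $(\mathbb T,G)$ is equicontinuous, and for every factor map $h:X\to Y$ onto an equicontinuous system $(Y,G)$ there is a factor map $p:\mathbb T\to Y$ with $p\circ\pi=h$. A factor map $h:X\to Y$ is called a topo-isomorphy if for every $G$-invariant Borel probability measure $\mu$ on $X$ it is an isomorphism mod $0$ with respect to $\mu$ and the push-forward $h(\mu)$; that is, there are measurable sets $M\subseteq X$ and $N\subseteq Y$ with $\mu(M)=h(\mu)(N)=1$ such that $h$ restricts to a bi-measurable, measure preserving bijection $M\to N$. Then $(X,G)$ is Weyl-mean equicontinuous if and only if $\pi:X\to\mathbb T$ is a topo-isomorphy. -/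

import Mathlib

open MeasureTheory Filter Topology

universe u

/-- A left Følner sequence of a locally compact group `G` with left Haar measure `m`: compact sets
of positive measure (in particular non-empty) with `m (g F_n ∆ F_n) / m (F_n) → 0` for every
`g ∈ G`. Positivity is stated for every index, so that all averages over `F_n` make sense. -/
structure IsFolnerSequence {G : Type*} [Group G] [TopologicalSpace G] [MeasurableSpace G]
    (m : Measure G) (F : ℕ → Set G) : Prop extends IsFoelner G m atTop F where
  isCompact : ∀ n, IsCompact (F n)
  measure_pos : ∀ n, 0 < m (F n)

/-- Amenability of a locally compact σ-compact group with left Haar measure `m`: a left Følner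
sequence exists. -/
def IsAmenableGroup {G : Type*} [Group G] [TopologicalSpace G] [MeasurableSpace G]
    (m : Measure G) : Prop :=
  ∃ F : ℕ → Set G, IsFolnerSequence m F

/-- The Besicovitch pseudometric along `F`:
`D_F(x, y) = limsup_n (1 / m(F_n)) ∫_{F_n} d(t x, t y) dm(t)`.
On a compact space the averages lie in `[0, diam X]`. -/
noncomputable def besicovitchDist {G : Type*} [Group G] [MeasurableSpace G] (m : Measure G)
    {X : Type*} [MetricSpace X] [MulAction G X] (F : ℕ → Set G) (x y : X) : ℝ :=
  limsup (fun n => ⨍ t in F n, dist (t • x) (t • y) ∂m) atTop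

/-- The Weyl pseudometric `D(x, y)`: the supremum of `D_F(x, y)` over all Følner sequences `F`
(a non-empty bounded family if `G` is amenable and `X` is compact). -/
noncomputable def weylDist {G : Type*} [Group G] [TopologicalSpace G] [MeasurableSpace G]
    (m : Measure G) {X : Type*} [MetricSpace X] [MulAction G X] (x y : X) : ℝ :=
  ⨆ F : {F : ℕ → Set G // IsFolnerSequence m F}, besicovitchDist m F.1 x y

/-- Weyl-mean equicontinuity of the action of `G` on `X`. -/
def IsWeylMeanEquicontinuous {G : Type*} [Group G] [TopologicalSpace G] [MeasurableSpace G]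
    (m : Measure G) (X : Type*) [MetricSpace X] [MulAction G X] : Prop :=
  ∀ ε > 0, ∃ δ > 0, ∀ x y : X, dist x y < δ → weylDist m x y < ε

/-- Equicontinuity of the action of `G` on `X`: for every `ε > 0` there is `δ > 0` such that
`d(x, y) < δ` implies `d(g x, g y) < ε` for all `g ∈ G`. -/
def IsEquicontinuousAction (G : Type*) [Group G] (X : Type*) [MetricSpace X] [MulAction G X] :
    Prop :=
  UniformEquicontinuous fun (g : G) (x : X) => g • x

/-- A factor map: a continuous equivariant surjection. -/
structure IsFactorMap (G : Type*) [Group G] {X Y : Type*} [TopologicalSpace X]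
    [TopologicalSpace Y] [MulAction G X] [MulAction G Y] (h : X → Y) : Prop where
  continuous : Continuous h
  surjective : Function.Surjective h
  map_smul : ∀ (g : G) (x : X), h (g • x) = g • h x

/-- `π : X → T` is (the factor map onto) the maximal equicontinuous factor of `X`: `T` is an
equicontinuous factor via `π`, and every equicontinuous factor `h : X → Y` factors through `π` by a
factor map `T → Y`. Every factor of `X` is conjugate to one living in the universe of `X`, so it is
enough to let `Y` range over that universe. -/
structure IsMaximalEquicontinuousFactor (G : Type*) [Group G] [TopologicalSpace G]
    {X : Type u} [MetricSpace X] [MulAction G X]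
    {T : Type*} [MetricSpace T] [MulAction G T] (π : X → T) : Prop where
  isFactorMap : IsFactorMap G π
  isEquicontinuous : IsEquicontinuousAction G T
  maximal : ∀ (Y : Type u) [MetricSpace Y] [CompactSpace Y] [MulAction G Y] [ContinuousSMul G Y]
    (h : X → Y), IsFactorMap G h → IsEquicontinuousAction G Y →
      ∃ p : T → Y, IsFactorMap G p ∧ p ∘ π = h

/-- A measurable map `h : X → Y` is an isomorphism mod 0 with respect to the probability measures
`μ` and `ν`: it agrees on a measurable set `M` of full measure with a bi-measurable measure
preserving bijection from `M` onto a measurable set `N` of full measure. -/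
def IsIsomorphismModZero {X Y : Type*} [MeasurableSpace X] [MeasurableSpace Y]
    (μ : Measure X) (ν : Measure Y) (h : X → Y) : Prop :=
  Measurable h ∧ ∃ (M : Set X) (N : Set Y), MeasurableSet M ∧ MeasurableSet N ∧
    μ M = 1 ∧ ν N = 1 ∧ ∃ e : M ≃ᵐ N,
      MeasurePreserving e (μ.comap Subtype.val) (ν.comap Subtype.val) ∧
      ∀ x : M, h x = e x

/-- A topo-isomorphy: a factor map which, for every `G`-invariant Borel probability measure `μ` on
`X`, is an isomorphism mod 0 with respect to `μ` and its push-forward. -/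
def IsTopoIsomorphy (G : Type*) [Group G] {X Y : Type*} [TopologicalSpace X] [TopologicalSpace Y]
    [MeasurableSpace X] [MeasurableSpace Y] [MulAction G X] [MulAction G Y] (h : X → Y) : Prop :=
  IsFactorMap G h ∧ ∀ (μ : Measure X) [IsProbabilityMeasure μ] [SMulInvariantMeasure G X μ],
    IsIsomorphismModZero μ (μ.map h) h

open scoped BoundedContinuousFunction in
/-- Every system has a maximal equicontinuous factor. -/
theorem exists_isMaximalEquicontinuousFactor (G : Type*) [Group G] [TopologicalSpace G]
    (X : Type u) [MetricSpace X] [CompactSpace X] [MulAction G X]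
    [ContinuousSMul G X] :
    ∃ (T : Type u) (_ : MetricSpace T) (_ : CompactSpace T) (_ : MulAction G T)
      (_ : ContinuousSMul G T) (π : X → T), IsMaximalEquicontinuousFactor G π := by
  classical
  let A : Set C(X, ℝ) := {f | UniformEquicontinuous fun (g : G) (x : X) => f (g • x)}
  have hA0 : (0 : C(X, ℝ)) ∈ A := by
    intro U hU
    filter_upwards with p g
    simpa using refl_mem_uniformity hU
  have : Nonempty A := ⟨⟨0, hA0⟩⟩
  let f : ℕ → A := TopologicalSpace.denseSeq A
  have hf : DenseRange f := TopologicalSpace.denseRange_denseSeq A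
  let c : ℕ → ℝ := fun n => (((n : ℝ) + 1) * (1 + ‖(f n : C(X, ℝ))‖))⁻¹
  have hc : ∀ n, 0 < c n := fun n => by positivity
  have hcb : ∀ n x, |c n * (f n : C(X, ℝ)) x| ≤ ((n : ℝ) + 1)⁻¹ := by
    intro n x
    have h1 : ‖(f n : C(X, ℝ)) x‖ ≤ ‖(f n : C(X, ℝ))‖ := ContinuousMap.norm_coe_le_norm _ x
    rw [Real.norm_eq_abs] at h1
    have h3 : 0 < 1 + ‖(f n : C(X, ℝ))‖ := by positivity
    have h4 : (0 : ℝ) < (n : ℝ) + 1 := by positivity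
    rw [abs_mul, abs_of_pos (hc n)]
    simp only [c]
    rw [inv_mul_eq_div, div_le_iff₀ (by positivity), inv_mul_cancel_left₀ h4.ne']
    linarith
  have hcb1 : ∀ n x, |c n * (f n : C(X, ℝ)) x| ≤ 1 := by
    intro n x
    refine (hcb n x).trans (inv_le_one_of_one_le₀ ?_)
    have : (0 : ℝ) ≤ n := Nat.cast_nonneg n
    linarith
  let F : X → (ℕ × G →ᵇ ℝ) := fun x => BoundedContinuousFunction.ofNormedAddCommGroup
    (fun p => c p.1 * (f p.1 : C(X, ℝ)) (p.2 • x))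
    (by
      rw [continuous_prod_of_discrete_left]
      intro n
      fun_prop) 1 (fun p => by rw [Real.norm_eq_abs]; exact hcb1 _ _)
  have hFapp : ∀ x n g, F x (n, g) = c n * (f n : C(X, ℝ)) (g • x) := fun x n g => rfl
  have hFg : ∀ (g : G) x y, dist (F (g • x)) (F (g • y)) ≤ dist (F x) (F y) := by
    intro g x y
    rw [BoundedContinuousFunction.dist_le dist_nonneg]
    rintro ⟨n, k⟩
    have := BoundedContinuousFunction.dist_coe_le_dist (f := F x) (g := F y) (n, k * g)
    simpa only [hFapp, mul_smul] using this
  have hFc : Continuous F := by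
    rw [Metric.continuous_iff']
    intro x₀ ε hε
    obtain ⟨N, hN⟩ := exists_nat_gt (4 / ε)
    have hfin : ∀ᶠ y in 𝓝 x₀, ∀ n ∈ Finset.range N, ∀ g : G,
        dist (F y (n, g)) (F x₀ (n, g)) < ε / 2 := by
      rw [eventually_all_finset]
      intro n _
      have h := UniformEquicontinuous.equicontinuous
        (show UniformEquicontinuous fun (g : G) (x : X) => (f n : C(X, ℝ)) (g • x) from (f n).2) x₀
      have h := h _ (Metric.dist_mem_uniformity (ε := ε / 2 / c n)
        (div_pos (half_pos hε) (hc n)))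
      filter_upwards [h] with y hy g
      have h2 : dist ((f n : C(X, ℝ)) (g • x₀)) ((f n : C(X, ℝ)) (g • y)) < ε / 2 / c n := hy g
      rw [lt_div_iff₀ (hc n), dist_comm, Real.dist_eq] at h2
      rw [hFapp, hFapp, Real.dist_eq, ← mul_sub, abs_mul, abs_of_pos (hc n)]
      linarith
    filter_upwards [hfin] with y hy
    refine lt_of_le_of_lt ((BoundedContinuousFunction.dist_le (half_pos hε).le).2 ?_)
      (half_lt_self hε)
    rintro ⟨n, g⟩
    by_cases hn : n < N
    · exact (hy n (Finset.mem_range.2 hn) g).le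
    · have h1 := hcb n (g • y)
      have h2 := hcb n (g • x₀)
      have hNn : (N : ℝ) ≤ n := by exact_mod_cast not_lt.1 hn
      have h3 : ((n : ℝ) + 1)⁻¹ ≤ ε / 4 := by
        rw [inv_le_comm₀ (by positivity) (by positivity), inv_div]
        linarith
      rw [hFapp, hFapp, Real.dist_eq]
      calc _ ≤ _ := abs_sub _ _
        _ ≤ ε / 2 := by linarith
  obtain ⟨T, q, hq, hqeq⟩ : ∃ (T : Type u) (q : X → T), Function.Surjective q ∧
      ∀ x y, q x = q y ↔ F x = F y :=
    ⟨Quotient (Setoid.ker F), Quotient.mk _, Quotient.mk_surjective, fun _ _ => Quotient.eq⟩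
  let r : T → X := Function.surjInv hq
  have hr : ∀ a, q (r a) = a := Function.surjInv_eq hq
  have hFr : ∀ x, F (r (q x)) = F x := fun x => (hqeq _ _).1 (hr _)
  have hL : Function.Injective fun a => F (r a) := by
    intro a b h
    rw [← hr a, ← hr b]
    exact (hqeq _ _).2 h
  let mT : MetricSpace T := MetricSpace.induced (fun a => F (r a)) hL inferInstance
  have hd : ∀ x y, dist (q x) (q y) = dist (F x) (F y) := fun x y => by
    rw [← hFr x, ← hFr y]
    rfl
  have hqc : Continuous q := by
    rw [Metric.continuous_iff']
    intro x ε hε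
    simpa only [hd] using (Metric.continuous_iff'.1 hFc) x ε hε
  have cT : CompactSpace T := hq.compactSpace hqc
  have hqg : ∀ (g : G) x y, q x = q y → q (g • x) = q (g • y) := fun g x y h => by
    have h1 := hFg g x y
    rw [(hqeq x y).1 h, dist_self] at h1
    exact (hqeq _ _).2 (dist_le_zero.1 h1)
  let aT : MulAction G T :=
    { smul := fun g a => q (g • r a)
      one_smul := fun a => by
        change q ((1 : G) • r a) = a
        rw [one_smul, hr]
      mul_smul := fun g k a => by
        change q ((g * k) • r a) = q (g • r (q (k • r a)))
        rw [mul_smul]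
        exact hqg _ _ _ (hr _).symm }
  have hqs : ∀ (g : G) x, q (g • x) = g • q x := fun g x => hqg _ _ _ (hr _).symm
  have hiso : ∀ (g : G) (a b : T), dist (g • a) (g • b) ≤ dist a b := by
    intro g a b
    obtain ⟨x, rfl⟩ := hq a
    obtain ⟨y, rfl⟩ := hq b
    rw [← hqs, ← hqs, hd, hd]
    exact hFg g x y
  have sT : ContinuousSMul G T := by
    constructor
    rw [continuous_iff_continuousAt]
    rintro ⟨g₀, a₀⟩
    obtain ⟨x₀, rfl⟩ := hq a₀
    have h1 : Tendsto (fun p : G × T => dist p.2 (q x₀) + dist (q (p.1 • x₀)) (q (g₀ • x₀)))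
        (𝓝 (g₀, q x₀)) (𝓝 0) := by
      have : Continuous (fun p : G × T =>
          dist p.2 (q x₀) + dist (q (p.1 • x₀)) (q (g₀ • x₀))) := by fun_prop
      simpa using this.tendsto (g₀, q x₀)
    rw [ContinuousAt, tendsto_iff_dist_tendsto_zero]
    refine squeeze_zero (fun _ => dist_nonneg) (fun p => ?_) h1
    refine (dist_triangle _ (p.1 • q x₀) _).trans ?_
    rw [hqs, hqs]
    exact add_le_add (hiso _ _ _) le_rfl
  refine ⟨T, mT, cT, aT, sT, q, ⟨hqc, hq, hqs⟩, ?_, ?_⟩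
  · refine Metric.uniformEquicontinuous_iff.2 fun ε hε => ⟨ε, hε, fun a b h g => ?_⟩
    exact (hiso g a b).trans_lt h
  · intro Y _ _ _ _ h hh hY
    have key : ∀ x y, q x = q y → h x = h y := by
      intro x y hxy
      have hF := (hqeq x y).1 hxy
      have hn : ∀ n, (f n : C(X, ℝ)) x = (f n : C(X, ℝ)) y := by
        intro n
        have := congrArg (fun φ : ℕ × G →ᵇ ℝ => φ (n, 1)) hF
        simpa [hFapp, (hc n).ne'] using this
      have hall : ∀ φ : A, (φ : C(X, ℝ)) x = (φ : C(X, ℝ)) y := by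
        intro φ
        refine congrFun (hf.equalizer (g := fun ψ : A => (ψ : C(X, ℝ)) x)
          (h := fun ψ : A => (ψ : C(X, ℝ)) y) ?_ ?_ (funext hn)) φ
        · exact (continuous_eval_const x).comp continuous_subtype_val
        · exact (continuous_eval_const y).comp continuous_subtype_val
      let ψ : C(X, ℝ) := ⟨fun z => dist (h z) (h x), by
        have := hh.continuous
        fun_prop⟩
      have hψ : ψ ∈ A := by
        change UniformEquicontinuous fun (g : G) (x : X) => ψ (g • x)
        refine Metric.uniformEquicontinuous_iff.2 fun ε hε => ?_
        obtain ⟨δ, hδ, hY'⟩ := Metric.uniformEquicontinuous_iff.1 hY ε hε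
        obtain ⟨η, hη, hu⟩ := Metric.uniformContinuous_iff.1
          (CompactSpace.uniformContinuous_of_continuous hh.continuous) δ hδ
        refine ⟨η, hη, fun a b hab g => ?_⟩
        have h1 := hY' _ _ (hu hab) g
        change dist (dist (h (g • a)) (h x)) (dist (h (g • b)) (h x)) < ε
        rw [hh.map_smul, hh.map_smul]
        exact (dist_dist_dist_le_left _ _ _).trans_lt h1
      have h1 : dist (h x) (h x) = dist (h y) (h x) := hall ⟨ψ, hψ⟩
      rw [dist_self] at h1
      exact (dist_eq_zero.1 h1.symm).symm
    have hquot : IsQuotientMap q := hqc.isClosedMap.isQuotientMap hqc hq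
    let p : T → Y := fun a => h (r a)
    have hpq : p ∘ q = h := funext fun x => key _ _ (hr _)
    refine ⟨p, ⟨?_, ?_, ?_⟩, hpq⟩
    · rw [hquot.continuous_iff, hpq]
      exact hh.continuous
    · intro z
      obtain ⟨x, rfl⟩ := hh.surjective z
      exact ⟨q x, congrFun hpq x⟩
    · intro g a
      obtain ⟨x, rfl⟩ := hq a
      rw [← hqs]
      exact (congrFun hpq _).trans ((hh.map_smul g x).trans (congrArg _ (congrFun hpq x).symm))

open scoped Pointwise symmDiff BoundedContinuousFunction

set_option linter.unusedSectionVars false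

/-! The bridge between the two properties is the behaviour of invariant measures on the fibre
product `{(x, y) | π x = π y}`: both directions turn on whether such measures live on the diagonal.

Topo-isomorphy implies Weyl-mean equicontinuity. Otherwise there are pairs whose distances tend to
`0` but whose Weyl distances stay at least `ε`. Orbit averages of each pair along a Følner sequence
accumulate at an invariant measure on `X × X` giving the metric integral at least `ε / 2`, and so
does a limit of these measures. Equicontinuity of the factor keeps the `π`-images of the pairs
uniformly close along orbits, so the limit lives on the fibre product
(`exists_measure_of_not_isWeylMeanEquicontinuous`). Since `π` is injective off a null set for the
marginals, the limit lives on the diagonal (`IsTopoIsomorphy.ae_fst_eq_snd`), a contradiction.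

Conversely, Weyl-mean equicontinuity says that the pseudometric `D` is continuous. It is also
invariant (`weylDist_smul_le`), so identifying points at `D`-distance zero gives an equicontinuous
factor; by maximality `D` vanishes on the fibres of `π`. For an invariant `μ`, the relatively
independent self-joining over `π` is invariant and lives on the fibre product, where `D = 0`.
Averaging the metric over Følner sets does not change its integral, while the averages tend to `0`;
hence the joining lives on the diagonal (`ae_fst_eq_snd_of_ae_weylDist_eq_zero`). The fibre measures
of `μ` are then Dirac measures, and `π` is injective on a set of full measure. -/

theorem setAverage_eq_integral_cond {G : Type*} [MeasurableSpace G] (m : Measure G) (s : Set G)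
    (f : G → ℝ) :
    ⨍ t in s, f t ∂m = ∫ t, f t ∂(ProbabilityTheory.cond m s) := by
  simp [average, ProbabilityTheory.cond]

/-! ### Asymptotic invariance of Følner averages -/

section Averages

variable {G : Type*} [Group G] [TopologicalSpace G] [IsTopologicalGroup G] [T2Space G]
  [MeasurableSpace G] [BorelSpace G] {m : Measure G} [IsFiniteMeasureOnCompacts m]

theorem IsFolnerSequence.isProbabilityMeasure_cond {F : ℕ → Set G} (hF : IsFolnerSequence m F)
    (n : ℕ) : IsProbabilityMeasure (ProbabilityTheory.cond m (F n)) :=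
  ProbabilityTheory.cond_isProbabilityMeasure_of_finite (hF.measure_pos n).ne'
    (hF.isCompact n).measure_lt_top.ne

/-- Averages of a bounded continuous function along a Følner sequence are asymptotically
invariant under left translation. -/
theorem IsFolnerSequence.tendsto_integral_mul_left_sub [m.IsMulLeftInvariant] {F : ℕ → Set G}
    (hF : IsFolnerSequence m F) (f : G →ᵇ ℝ) (g : G) :
    Tendsto (fun n => ∫ t, f (g * t) ∂(ProbabilityTheory.cond m (F n)) -
      ∫ t, f t ∂(ProbabilityTheory.cond m (F n))) atTop (𝓝 0) := by
  have hlim := (ENNReal.tendsto_toReal ENNReal.zero_ne_top).comp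
    (hF.tendsto_meas_smul_symmDiff g)
  have hlim := hlim.const_mul ‖f‖
  rw [ENNReal.toReal_zero, mul_zero] at hlim
  refine squeeze_zero_norm (fun n => ?_) hlim
  have hms : MeasurableSet (F n) := (hF.isCompact n).measurableSet
  have hgc : IsCompact (g • F n) := (hF.isCompact n).smul g
  have hmg : MeasurableSet (g • F n) := hgc.measurableSet
  have hfc : Continuous f := f.continuous
  have hi : ∀ s : Set G, m s < ⊤ → IntegrableOn f s m := fun s hs =>
    Measure.integrableOn_of_bounded hs.ne hfc.aestronglyMeasurable
      (M := ‖f‖) (ae_of_all _ fun t => f.norm_coe_le_norm t)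
  have h1 : ∫ t in F n, f (g * t) ∂m = ∫ t in g • F n, f t ∂m := by
    have := (measurePreserving_mul_left m g).setIntegral_image_emb
      (measurableEmbedding_mulLeft g) f (F n)
    rw [← this]
    rfl
  have hA := (hF.isCompact n).measure_lt_top (μ := m)
  have hB := hgc.measure_lt_top (μ := m)
  -- The integrals over `F n ∩ g • F n` cancel, so only the symmetric difference contributes.
  have h2 : ∫ t in g • F n, f t ∂m - ∫ t in F n, f t ∂m
      = ∫ t in (g • F n) \ F n, f t ∂m - ∫ t in F n \ (g • F n), f t ∂m := by
    rw [← integral_inter_add_sdiff hms (hi _ hB), ← integral_inter_add_sdiff hmg (hi _ hA),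
      Set.inter_comm]
    ring
  have h3 : ∀ s : Set G, m s < ⊤ → ‖∫ t in s, f t ∂m‖ ≤ ‖f‖ * m.real s := fun s hs =>
    norm_setIntegral_le_of_norm_le_const hs (fun t _ => f.norm_coe_le_norm t)
  have hd1 : m ((g • F n) \ F n) < ⊤ := (measure_mono Set.sdiff_subset).trans_lt hB
  have hd2 : m (F n \ (g • F n)) < ⊤ := (measure_mono Set.sdiff_subset).trans_lt hA
  have h4 : m.real ((g • F n) ∆ F n) = m.real ((g • F n) \ F n) + m.real (F n \ (g • F n)) := by
    rw [Set.symmDiff_def, measureReal_union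
      (Set.disjoint_left.2 fun x hx hy => hx.2 hy.1) (hms.diff hmg) hd1.ne hd2.ne]
  rw [← setAverage_eq_integral_cond, ← setAverage_eq_integral_cond, setAverage_eq,
    setAverage_eq, ← smul_sub, h1, h2, norm_smul, Function.comp_apply, ENNReal.toReal_div,
    Real.norm_of_nonneg (inv_nonneg.2 measureReal_nonneg)]
  change _ ≤ ‖f‖ * (m.real ((g • F n) ∆ F n) / m.real (F n))
  rw [← mul_div_assoc, div_eq_inv_mul]
  refine mul_le_mul_of_nonneg_left ?_ (inv_nonneg.2 measureReal_nonneg)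
  rw [h4, mul_add]
  exact (norm_sub_le _ _).trans (add_le_add (h3 _ hd1) (h3 _ hd2))

end Averages

/-! ### Right translates of Følner sequences -/

section RightTranslation

variable {G : Type*} [Group G] [TopologicalSpace G] [IsTopologicalGroup G] [T2Space G]
  [LocallyCompactSpace G] [SigmaCompactSpace G] [MeasurableSpace G] [BorelSpace G]
  {m : Measure G} [m.IsHaarMeasure] [m.Regular]

theorem measure_eq_modularCharacterFun_mul (g : G) (s : Set G) :
    m s = Measure.modularCharacterFun g * m ((· * g) '' s) := by
  have h := Measure.map_right_mul_eq_modularCharacterFun_smul m g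
  have he : MeasurableEmbedding (· * g) := measurableEmbedding_mulRight g
  have := congrArg (fun ν : Measure G => ν ((· * g) '' s)) h
  simp only [he.map_apply, Set.preimage_image_eq _ he.injective] at this
  rw [this]
  rfl

/-- The modular factor appears both in the integral and in the measure of the set, so it cancels in
the average. -/
theorem setAverage_image_mul_right (g : G) (s : Set G) (f : G → ℝ) :
    ⨍ t in (· * g) '' s, f t ∂m = ⨍ t in s, f (t * g) ∂m := by
  have h := Measure.map_right_mul_eq_modularCharacterFun_smul m g
  have he : MeasurableEmbedding (· * g) := measurableEmbedding_mulRight g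
  have hc : (0 : ℝ) < Measure.modularCharacterFun g := Measure.modularCharacterFun_pos g
  have h1 : ∫ t in s, f (t * g) ∂m
      = Measure.modularCharacterFun g * ∫ t in (· * g) '' s, f t ∂m := by
    have h2 := he.setIntegral_map (μ := m) f ((· * g) '' s)
    rw [Set.preimage_image_eq _ he.injective, h] at h2
    rw [← h2, Measure.restrict_smul, integral_smul_nnreal_measure]
    rfl
  have h3 : m.real s = Measure.modularCharacterFun g * m.real ((· * g) '' s) := by
    rw [measureReal_def, measure_eq_modularCharacterFun_mul g s, ENNReal.toReal_mul]
    rfl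
  rw [setAverage_eq, setAverage_eq, h1, h3, mul_inv, smul_eq_mul, smul_eq_mul]
  field_simp

/-- Left and right translations commute, so the symmetric difference is right-translated too, and
the modular factor cancels in the quotient. This is the source of the invariance of the Weyl
pseudometric. -/
theorem IsFolnerSequence.mul_right {F : ℕ → Set G} (hF : IsFolnerSequence m F) (g : G) :
    IsFolnerSequence m fun n => (· * g) '' F n := by
  have hc : (Measure.modularCharacterFun g : ENNReal) ≠ 0 := by
    exact_mod_cast (Measure.modularCharacterFun_pos g).ne'
  have hcomp : ∀ n, IsCompact ((· * g) '' F n) := fun n =>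
    (hF.isCompact n).image (continuous_mul_const g)
  have hpos : ∀ n, 0 < m ((· * g) '' F n) := fun n => by
    have h := hF.measure_pos n
    rw [measure_eq_modularCharacterFun_mul g] at h
    exact pos_of_ne_zero fun h0 => by rw [h0, mul_zero] at h; exact h.false
  refine ⟨⟨.of_forall fun n => (hcomp n).measurableSet, .of_forall fun n => (hpos n).ne',
    .of_forall fun n => (hcomp n).measure_lt_top.ne, fun k => ?_⟩, hcomp, hpos⟩
  refine (hF.tendsto_meas_smul_symmDiff k).congr fun n => ?_
  have : (k • (· * g) '' F n) ∆ ((· * g) '' F n) = (· * g) '' ((k • F n) ∆ F n) := by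
    rw [Set.image_symmDiff (mul_left_injective g)]
    simp only [← Set.image_smul, Set.image_image, smul_eq_mul, mul_assoc]
  rw [this, measure_eq_modularCharacterFun_mul g (F n),
    measure_eq_modularCharacterFun_mul g ((k • F n) ∆ F n),
    ENNReal.mul_div_mul_left _ _ hc ENNReal.coe_ne_top]

end RightTranslation

/-! ### The Weyl pseudometric -/

section WeylDist

variable {G : Type*} [Group G] [TopologicalSpace G] [IsTopologicalGroup G] [T2Space G]
  [MeasurableSpace G] [BorelSpace G] {m : Measure G} [IsFiniteMeasureOnCompacts m]
  {X : Type*} [MetricSpace X] [CompactSpace X] [MulAction G X] [ContinuousSMul G X]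
  {F : ℕ → Set G}

theorem continuous_dist_smul_smul (x y : X) :
    Continuous fun t : G => dist (t • x) (t • y) := by fun_prop

theorem dist_le_diam_univ (x y : X) : dist x y ≤ Metric.diam (Set.univ : Set X) :=
  Metric.dist_le_diam_of_mem isCompact_univ.isBounded trivial trivial

theorem integrable_dist_smul_smul (P : Measure G) [IsFiniteMeasure P] (x y : X) :
    Integrable (fun t : G => dist (t • x) (t • y)) P :=
  Integrable.of_bound (continuous_dist_smul_smul x y).aestronglyMeasurable
    (Metric.diam (Set.univ : Set X)) (ae_of_all _ fun t => by
      rw [Real.norm_of_nonneg dist_nonneg]; exact dist_le_diam_univ _ _)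

theorem setAverage_dist_nonneg (m : Measure G) (s : Set G) (x y : X) :
    0 ≤ ⨍ t in s, dist (t • x) (t • y) ∂m :=
  integral_nonneg fun _ => dist_nonneg

theorem IsFolnerSequence.setAverage_dist_le_diam (hF : IsFolnerSequence m F) (x y : X) (n : ℕ) :
    ⨍ t in F n, dist (t • x) (t • y) ∂m ≤ Metric.diam (Set.univ : Set X) := by
  have := hF.isProbabilityMeasure_cond n
  rw [setAverage_eq_integral_cond]
  refine (integral_mono (integrable_dist_smul_smul _ x y) (integrable_const _)
    fun t => dist_le_diam_univ _ _).trans ?_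
  simp

theorem IsFolnerSequence.isBoundedUnder_le (hF : IsFolnerSequence m F) (x y : X) :
    IsBoundedUnder (· ≤ ·) atTop fun n => ⨍ t in F n, dist (t • x) (t • y) ∂m :=
  isBoundedUnder_of ⟨_, hF.setAverage_dist_le_diam x y⟩

theorem isBoundedUnder_ge_setAverage_dist (m : Measure G) (F : ℕ → Set G) (x y : X) :
    IsBoundedUnder (· ≥ ·) atTop fun n => ⨍ t in F n, dist (t • x) (t • y) ∂m :=
  isBoundedUnder_of ⟨0, fun n => setAverage_dist_nonneg m (F n) x y⟩

theorem IsFolnerSequence.besicovitchDist_nonneg (hF : IsFolnerSequence m F) (x y : X) :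
    0 ≤ besicovitchDist m F x y :=
  le_limsup_of_frequently_le (Frequently.of_forall fun n => setAverage_dist_nonneg m (F n) x y)
    (hF.isBoundedUnder_le x y)

theorem IsFolnerSequence.besicovitchDist_le_diam (hF : IsFolnerSequence m F) (x y : X) :
    besicovitchDist m F x y ≤ Metric.diam (Set.univ : Set X) :=
  limsup_le_of_le (isBoundedUnder_ge_setAverage_dist m F x y).isCoboundedUnder_le
    (.of_forall (hF.setAverage_dist_le_diam x y))

theorem IsFolnerSequence.besicovitchDist_triangle (hF : IsFolnerSequence m F) (x y z : X) :
    besicovitchDist m F x z ≤ besicovitchDist m F x y + besicovitchDist m F y z := by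
  refine le_trans ?_ (limsup_add_le (isBoundedUnder_ge_setAverage_dist m F x y)
    (hF.isBoundedUnder_le x y) (isBoundedUnder_ge_setAverage_dist m F y z).isCoboundedUnder_le
    (hF.isBoundedUnder_le y z))
  refine limsup_le_limsup (.of_forall fun n => ?_)
    (isBoundedUnder_ge_setAverage_dist m F x z).isCoboundedUnder_le
    (isBoundedUnder_le_add (hF.isBoundedUnder_le x y) (hF.isBoundedUnder_le y z))
  have := hF.isProbabilityMeasure_cond n
  simp only [Pi.add_apply, setAverage_eq_integral_cond]
  rw [← integral_add (integrable_dist_smul_smul _ x y) (integrable_dist_smul_smul _ y z)]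
  exact integral_mono (integrable_dist_smul_smul _ x z)
    ((integrable_dist_smul_smul _ x y).add (integrable_dist_smul_smul _ y z))
    fun t => dist_triangle _ _ _

theorem bddAbove_range_besicovitchDist (m : Measure G) [IsFiniteMeasureOnCompacts m] (x y : X) :
    BddAbove (Set.range fun F : {F : ℕ → Set G // IsFolnerSequence m F} =>
      besicovitchDist m F.1 x y) :=
  ⟨_, Set.forall_mem_range.2 fun F => F.2.besicovitchDist_le_diam x y⟩

theorem IsFolnerSequence.besicovitchDist_le_weylDist (hF : IsFolnerSequence m F) (x y : X) :
    besicovitchDist m F x y ≤ weylDist m x y :=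
  le_ciSup (bddAbove_range_besicovitchDist m x y) ⟨F, hF⟩

theorem weylDist_nonneg (m : Measure G) [IsFiniteMeasureOnCompacts m] (x y : X) :
    0 ≤ weylDist m x y :=
  Real.iSup_nonneg fun F => F.2.besicovitchDist_nonneg x y

theorem weylDist_self (m : Measure G) (x : X) : weylDist m x x = 0 := by
  simp [weylDist, besicovitchDist, average]

theorem weylDist_comm (m : Measure G) (x y : X) : weylDist m x y = weylDist m y x := by
  simp only [weylDist, besicovitchDist, dist_comm]

theorem weylDist_triangle (m : Measure G) [IsFiniteMeasureOnCompacts m] (x y z : X) :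
    weylDist m x z ≤ weylDist m x y + weylDist m y z :=
  -- A real supremum over an empty family is `0`, which is why the bound must also be shown
  -- nonnegative.
  Real.iSup_le (fun F => (F.2.besicovitchDist_triangle x y z).trans
    (add_le_add (F.2.besicovitchDist_le_weylDist x y) (F.2.besicovitchDist_le_weylDist y z)))
    (add_nonneg (weylDist_nonneg m x y) (weylDist_nonneg m y z))

theorem IsFolnerSequence.tendsto_setAverage_dist (hF : IsFolnerSequence m F) {x y : X}
    (hxy : weylDist m x y = 0) :
    Tendsto (fun n => ⨍ t in F n, dist (t • x) (t • y) ∂m) atTop (𝓝 0) :=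
  tendsto_of_le_liminf_of_limsup_le
    (le_liminf_of_le (hF.isBoundedUnder_le x y).isCoboundedUnder_ge
      (.of_forall fun n => setAverage_dist_nonneg m (F n) x y))
    (hxy ▸ hF.besicovitchDist_le_weylDist x y) (hF.isBoundedUnder_le x y)
    (isBoundedUnder_ge_setAverage_dist m F x y)

end WeylDist

/-- Averaging `d(t g x, t g y)` over `F n` is averaging `d(t x, t y)` over the right translate of `F
n` by `g`. That is again a Følner sequence, hence admissible in the supremum. -/
theorem weylDist_smul_le {G : Type*} [Group G] [TopologicalSpace G] [IsTopologicalGroup G]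
    [T2Space G] [LocallyCompactSpace G] [SigmaCompactSpace G] [MeasurableSpace G] [BorelSpace G]
    (m : Measure G) [m.IsHaarMeasure] [m.Regular]
    {X : Type*} [MetricSpace X] [CompactSpace X] [MulAction G X] [ContinuousSMul G X]
    (g : G) (x y : X) : weylDist m (g • x) (g • y) ≤ weylDist m x y := by
  refine Real.iSup_le (fun F => ?_) (weylDist_nonneg m x y)
  refine le_of_eq_of_le ?_ ((F.2.mul_right g).besicovitchDist_le_weylDist x y)
  simp only [besicovitchDist, setAverage_image_mul_right, mul_smul]

/-- A continuous invariant pseudometric vanishes on the fibres of the maximal equicontinuous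
factor. -/
theorem IsMaximalEquicontinuousFactor.pseudoDist_eq_zero {G : Type*} [Group G]
    [TopologicalSpace G] {X : Type u} [MetricSpace X] [CompactSpace X] [MulAction G X]
    [ContinuousSMul G X] {T : Type*} [MetricSpace T] [MulAction G T] {π : X → T}
    (hπ : IsMaximalEquicontinuousFactor G π) (ρ : X → X → ℝ) (h_self : ∀ x, ρ x x = 0)
    (h_comm : ∀ x y, ρ x y = ρ y x) (h_triangle : ∀ x y z, ρ x z ≤ ρ x y + ρ y z)
    (h_smul : ∀ (g : G) x y, ρ (g • x) (g • y) ≤ ρ x y)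
    (h_cont : ∀ ε > 0, ∃ δ > 0, ∀ x y, dist x y < δ → ρ x y < ε)
    {x y : X} (hxy : π x = π y) : ρ x y = 0 := by
  -- The factor is the metric quotient of `(X, ρ)`. The second pseudometric on `X` stays confined to
  -- this existence proof, away from the given one.
  obtain ⟨Y, mY, q, hq, hd⟩ : ∃ (Y : Type u) (_ : MetricSpace Y) (q : X → Y),
      Function.Surjective q ∧ ∀ x y, dist (q x) (q y) = ρ x y := by
    let pX : PseudoMetricSpace X :=
      { dist := ρ, dist_self := h_self, dist_comm := h_comm, dist_triangle := h_triangle }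
    exact ⟨@SeparationQuotient X pX.toUniformSpace.toTopologicalSpace,
      @SeparationQuotient.instMetricSpace X pX, @SeparationQuotient.mk X _,
      @SeparationQuotient.surjective_mk X _, fun x y => rfl⟩
  have hqeq : ∀ x y, q x = q y ↔ ρ x y = 0 := fun x y => by rw [← dist_eq_zero, hd]
  have hρ0 : ∀ x y, 0 ≤ ρ x y := fun x y => hd x y ▸ dist_nonneg
  have hqc : Continuous q := Metric.continuous_iff.2 fun b ε hε => by
    simpa only [hd] using (h_cont ε hε).imp fun δ h => ⟨h.1, fun a => h.2 a b⟩
  have cY : CompactSpace Y := hq.compactSpace hqc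
  let r : Y → X := Function.surjInv hq
  have hr : ∀ a, q (r a) = a := Function.surjInv_eq hq
  have hqg : ∀ (g : G) x y, q x = q y → q (g • x) = q (g • y) := fun g x y h =>
    (hqeq _ _).2 (le_antisymm ((h_smul g x y).trans ((hqeq _ _).1 h).le) (hρ0 _ _))
  let aY : MulAction G Y :=
    { smul := fun g a => q (g • r a)
      one_smul := fun a => by
        change q ((1 : G) • r a) = a
        rw [one_smul, hr]
      mul_smul := fun g k a => by
        change q ((g * k) • r a) = q (g • r (q (k • r a)))
        rw [mul_smul]
        exact hqg _ _ _ (hr _).symm }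
  have hqs : ∀ (g : G) x, q (g • x) = g • q x := fun g x => hqg _ _ _ (hr _).symm
  have hiso : ∀ (g : G) (a b : Y), dist (g • a) (g • b) ≤ dist a b := by
    intro g a b
    obtain ⟨x, rfl⟩ := hq a
    obtain ⟨y, rfl⟩ := hq b
    rw [← hqs, ← hqs, hd, hd]
    exact h_smul g x y
  -- Joint continuity: the action on `Y` does not increase distances, and orbit maps are continuous
  -- because they lift to `X`.
  have sY : ContinuousSMul G Y := by
    constructor
    rw [continuous_iff_continuousAt]
    rintro ⟨g₀, a₀⟩
    obtain ⟨x₀, rfl⟩ := hq a₀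
    have h1 : Tendsto (fun p : G × Y => dist p.2 (q x₀) + dist (q (p.1 • x₀)) (q (g₀ • x₀)))
        (𝓝 (g₀, q x₀)) (𝓝 0) := by
      have : Continuous (fun p : G × Y =>
          dist p.2 (q x₀) + dist (q (p.1 • x₀)) (q (g₀ • x₀))) := by fun_prop
      simpa using this.tendsto (g₀, q x₀)
    rw [ContinuousAt, tendsto_iff_dist_tendsto_zero]
    refine squeeze_zero (fun _ => dist_nonneg) (fun p => ?_) h1
    refine (dist_triangle _ (p.1 • q x₀) _).trans ?_
    rw [hqs, hqs]
    exact add_le_add (hiso _ _ _) le_rfl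
  obtain ⟨p, -, hp⟩ := hπ.maximal Y q ⟨hqc, hq, hqs⟩
    (Metric.uniformEquicontinuous_iff.2 fun ε hε => ⟨ε, hε, fun a b h g =>
      (hiso g a b).trans_lt h⟩)
  rw [← hqeq, ← hp, Function.comp_apply, Function.comp_apply, hxy]

/-! ### Invariant measures as weak limits -/

section InvariantMeasures

variable {G : Type*} [Group G] [TopologicalSpace G]
  {Z : Type*} [MetricSpace Z] [CompactSpace Z] [MeasurableSpace Z] [BorelSpace Z]
  [MulAction G Z] [ContinuousSMul G Z]

theorem smulInvariantMeasure_of_forall_integral_eq {μ : Measure Z} [IsFiniteMeasure μ]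
    (h : ∀ (g : G) (f : Z →ᵇ ℝ), ∫ z, f (g • z) ∂μ = ∫ z, f z ∂μ) : SMulInvariantMeasure G Z μ := by
  refine ⟨fun g s hs => ?_⟩
  have hg : Measurable fun z : Z => g • z := (continuous_const_smul g).measurable
  have : μ.map (fun z => g • z) = μ := by
    refine ext_of_forall_integral_eq_of_IsFiniteMeasure fun f => ?_
    rw [integral_map hg.aemeasurable f.continuous.aestronglyMeasurable, h]
  conv_rhs => rw [← this]
  rw [Measure.map_apply hg hs]

theorem integral_smul_eq_of_smulInvariantMeasure (μ : Measure Z) [SMulInvariantMeasure G Z μ]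
    (g : G) (f : Z →ᵇ ℝ) : ∫ z, f (g • z) ∂μ = ∫ z, f z ∂μ := by
  have hg : Measurable fun z : Z => g • z := (continuous_const_smul g).measurable
  have : μ.map (fun z => g • z) = μ := by
    ext s hs
    rw [Measure.map_apply hg hs]
    exact SMulInvariantMeasure.measure_preimage_smul g hs
  conv_rhs => rw [← this]
  rw [integral_map hg.aemeasurable f.continuous.aestronglyMeasurable]

theorem exists_tendsto_integral_of_ultrafilter {ι : Type*} (U : Ultrafilter ι)
    (P : ι → Measure Z) [hP : ∀ i, IsProbabilityMeasure (P i)] :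
    ∃ μ : Measure Z, IsProbabilityMeasure μ ∧
      ∀ f : Z →ᵇ ℝ, Tendsto (fun i => ∫ z, f z ∂(P i)) U (𝓝 (∫ z, f z ∂μ)) := by
  obtain ⟨μ, -, hμ⟩ := (isCompact_univ (X := ProbabilityMeasure Z)).ultrafilter_le_nhds
    (U.map fun i => (⟨P i, hP i⟩ : ProbabilityMeasure Z)) (by simp)
  exact ⟨μ, inferInstance, ProbabilityMeasure.tendsto_iff_forall_integral_tendsto.1 hμ⟩

/-- Weak compactness gives a limit along the ultrafilter without passing to subsequences, and
asymptotic invariance becomes invariance in the limit. -/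
theorem exists_smulInvariantMeasure_of_ultrafilter {ι : Type*} (U : Ultrafilter ι)
    (P : ι → Measure Z) [hP : ∀ i, IsProbabilityMeasure (P i)]
    (hinv : ∀ (g : G) (f : Z →ᵇ ℝ),
      Tendsto (fun i => ∫ z, f (g • z) ∂(P i) - ∫ z, f z ∂(P i)) U (𝓝 0)) :
    ∃ μ : Measure Z, IsProbabilityMeasure μ ∧ SMulInvariantMeasure G Z μ ∧
      ∀ f : Z →ᵇ ℝ, Tendsto (fun i => ∫ z, f z ∂(P i)) U (𝓝 (∫ z, f z ∂μ)) := by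
  obtain ⟨μ, hμ, h⟩ := exists_tendsto_integral_of_ultrafilter U P
  refine ⟨μ, hμ, smulInvariantMeasure_of_forall_integral_eq fun g f => ?_, h⟩
  have h1 := h (f.compContinuous ⟨fun z => g • z, continuous_const_smul g⟩)
  exact sub_eq_zero.1 (tendsto_nhds_unique (h1.sub (h f)) (hinv g f))

/-- Orbit averages along a Følner sequence accumulate at invariant measures. -/
theorem IsFolnerSequence.exists_smulInvariantMeasure [IsTopologicalGroup G] [T2Space G]
    [MeasurableSpace G] [BorelSpace G] {m : Measure G} [IsFiniteMeasureOnCompacts m]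
    [m.IsMulLeftInvariant] {F : ℕ → Set G} (hF : IsFolnerSequence m F) (U : Ultrafilter ℕ)
    (hU : (U : Filter ℕ) ≤ atTop) (z : Z) :
    ∃ μ : Measure Z, IsProbabilityMeasure μ ∧ SMulInvariantMeasure G Z μ ∧
      ∀ f : Z →ᵇ ℝ, Tendsto (fun n => ⨍ t in F n, f (t • z) ∂m) U (𝓝 (∫ w, f w ∂μ)) := by
  have hP := hF.isProbabilityMeasure_cond
  have hc : Continuous fun t : G => t • z := continuous_id.smul continuous_const
  -- Orbit averages are integrals against the push-forward of normalised `m` on `F n` under `t ↦ t •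
  -- z`; since `(g * t) • z = g • (t • z)`, asymptotic invariance on `G` passes to `Z`.
  have hP' : ∀ n, IsProbabilityMeasure ((ProbabilityTheory.cond m (F n)).map fun t => t • z) :=
    fun n => Measure.isProbabilityMeasure_map hc.measurable.aemeasurable
  have hint : ∀ n (f : Z →ᵇ ℝ), ∫ w, f w ∂((ProbabilityTheory.cond m (F n)).map fun t => t • z) =
      ∫ t, f (t • z) ∂(ProbabilityTheory.cond m (F n)) := fun n f =>
    integral_map hc.measurable.aemeasurable f.continuous.aestronglyMeasurable
  obtain ⟨μ, hμ, hinv, h⟩ := exists_smulInvariantMeasure_of_ultrafilter (G := G) U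
    (fun n => (ProbabilityTheory.cond m (F n)).map fun t => t • z) (fun g f => by
      have h1 := hF.tendsto_integral_mul_left_sub (f.compContinuous ⟨fun t => t • z, hc⟩) g
      refine (h1.mono_left hU).congr fun n => ?_
      have h2 := hint n (f.compContinuous ⟨fun w => g • w, continuous_const_smul g⟩)
      simp only [BoundedContinuousFunction.compContinuous_apply, ContinuousMap.coe_mk] at h2 ⊢
      rw [hint, h2]
      simp only [mul_smul])
  refine ⟨μ, hμ, hinv, fun f => (h f).congr fun n => ?_⟩
  rw [setAverage_eq_integral_cond, hint]

end InvariantMeasures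

/-! ### From topo-isomorphy to Weyl-mean equicontinuity -/

section Pairs

variable {G : Type*} [Group G] [TopologicalSpace G] [IsTopologicalGroup G] [T2Space G]
  [MeasurableSpace G] [BorelSpace G] {m : Measure G} [IsFiniteMeasureOnCompacts m]
  [m.IsMulLeftInvariant]
  {X : Type*} [MetricSpace X] [CompactSpace X] [MeasurableSpace X] [BorelSpace X]
  [MulAction G X] [ContinuousSMul G X]

/-- The Weyl distance of two points is approximated by integrals of the metric with respect to
invariant measures on the orbit closure of the pair. -/
theorem exists_smulInvariantMeasure_of_lt_weylDist (hG : IsAmenableGroup m) {x y : X} {c : ℝ}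
    (hc : c < weylDist m x y) :
    ∃ μ : Measure (X × X), IsProbabilityMeasure μ ∧ SMulInvariantMeasure G (X × X) μ ∧
      c ≤ ∫ z, dist z.1 z.2 ∂μ ∧
      ∀ (f : X × X →ᵇ ℝ) (b : ℝ), (∀ t : G, f (t • (x, y)) ≤ b) → ∫ z, f z ∂μ ≤ b := by
  have : Nonempty {F : ℕ → Set G // IsFolnerSequence m F} := let ⟨F, hF⟩ := hG; ⟨⟨F, hF⟩⟩
  obtain ⟨⟨F, hF⟩, hcF⟩ := exists_lt_of_lt_ciSup hc
  have hfreq := frequently_lt_of_lt_limsup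
    (isBoundedUnder_ge_setAverage_dist m F x y).isCoboundedUnder_le hcF
  -- The averages exceed `c` only for infinitely many `n`; the ultrafilter is chosen to concentrate
  -- on these.
  have hne : (atTop ⊓ 𝓟 {n | c < ⨍ t in F n, dist (t • x) (t • y) ∂m}).NeBot :=
    frequently_mem_iff_neBot.1 hfreq
  let U : Ultrafilter ℕ := .of (atTop ⊓ 𝓟 {n | c < ⨍ t in F n, dist (t • x) (t • y) ∂m})
  have hU := Ultrafilter.of_le (atTop ⊓ 𝓟 {n | c < ⨍ t in F n, dist (t • x) (t • y) ∂m})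
  obtain ⟨μ, hμ, hinv, h⟩ :=
    hF.exists_smulInvariantMeasure U (hU.trans inf_le_left) (x, y)
  refine ⟨μ, hμ, hinv, ?_, fun f b hb => ?_⟩
  · refine ge_of_tendsto (h (BoundedContinuousFunction.mkOfCompact
      ⟨fun z : X × X => dist z.1 z.2, by fun_prop⟩)) ?_
    have : ∀ᶠ n in (U : Filter ℕ), c < ⨍ t in F n, dist (t • x) (t • y) ∂m :=
      le_principal_iff.1 (hU.trans inf_le_right)
    exact this.mono fun n hn => hn.le
  · refine le_of_tendsto (h f) (.of_forall fun n => ?_)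
    have := hF.isProbabilityMeasure_cond n
    rw [setAverage_eq_integral_cond]
    have hcont : Continuous fun t : G => f (t • (x, y)) := by fun_prop
    refine (integral_mono (Integrable.of_bound hcont.aestronglyMeasurable ‖f‖
      (ae_of_all _ fun t => f.norm_coe_le_norm _)) (integrable_const b) hb).trans ?_
    simp

/-- If the system is not Weyl-mean equicontinuous, some invariant measure on the fibre product over
an equicontinuous factor is not carried by the diagonal. -/
theorem exists_measure_of_not_isWeylMeanEquicontinuous (hG : IsAmenableGroup m)
    {T : Type*} [MetricSpace T] [MulAction G T] {π : X → T} (hπ : IsFactorMap G π)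
    (hT : IsEquicontinuousAction G T) (hX : ¬ IsWeylMeanEquicontinuous m X) :
    ∃ μ : Measure (X × X), IsProbabilityMeasure μ ∧ SMulInvariantMeasure G (X × X) μ ∧
      0 < ∫ z, dist z.1 z.2 ∂μ ∧ ∀ᵐ z ∂μ, π z.1 = π z.2 := by
  have hπc := hπ.continuous
  simp only [IsWeylMeanEquicontinuous, not_forall, not_exists, not_and, not_lt] at hX
  obtain ⟨ε, hε, hX⟩ := hX
  choose x y hxy hD using fun k : ℕ => hX (1 / ((k : ℝ) + 1)) (by positivity)
  have hxy : ∀ k, dist (x k) (y k) < 1 / ((k : ℝ) + 1) := hxy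
  choose P hP hPinv hPd hPb using fun k => exists_smulInvariantMeasure_of_lt_weylDist hG
    ((half_lt_self hε).trans_le (hD k))
  let U : Ultrafilter ℕ := .of atTop
  have hU : (U : Filter ℕ) ≤ atTop := Ultrafilter.of_le _
  obtain ⟨μ, hμ, hinv, h⟩ := exists_smulInvariantMeasure_of_ultrafilter (G := G) U P
    (fun g f => by simp [integral_smul_eq_of_smulInvariantMeasure])
  refine ⟨μ, hμ, hinv, (half_pos hε).trans_le ?_, ?_⟩
  · exact ge_of_tendsto (h (BoundedContinuousFunction.mkOfCompact
      ⟨fun z : X × X => dist z.1 z.2, by fun_prop⟩)) (.of_forall hPd)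
  let f : X × X →ᵇ ℝ := BoundedContinuousFunction.mkOfCompact
    ⟨fun z : X × X => dist (π z.1) (π z.2), by fun_prop⟩
  have hf : ∀ z, f z = dist (π z.1) (π z.2) := fun z => rfl
  have hle : ∫ z, f z ∂μ ≤ 0 := by
    -- For large `k`, equicontinuity of `T` bounds the `π`-distance by `b` along the whole orbit of
    -- `(x k, y k)`, hence its integral against `P k`.
    refine le_of_forall_gt_imp_ge_of_dense fun b hb => ?_
    obtain ⟨δ, hδ, hδT⟩ := Metric.uniformEquicontinuous_iff.1 hT b hb
    obtain ⟨η, hη, hu⟩ := Metric.uniformContinuous_iff.1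
      (CompactSpace.uniformContinuous_of_continuous hπc) δ hδ
    refine le_of_tendsto (h f) (hU ?_)
    filter_upwards [(tendsto_one_div_add_atTop_nhds_zero_nat (𝕜 := ℝ)).eventually_lt_const hη]
      with k hk
    refine hPb k f b fun t => ?_
    have := hδT _ _ (hu ((hxy k).trans hk)) t
    rw [hf, Prod.smul_fst, Prod.smul_snd, hπ.map_smul, hπ.map_smul]
    exact this.le
  have hz := (integral_eq_zero_iff_of_nonneg (μ := μ) (fun z => by rw [hf]; exact dist_nonneg)
    (f.integrable μ)).1 (hle.antisymm (integral_nonneg fun z => by rw [hf]; exact dist_nonneg))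
  filter_upwards [hz] with z hz
  exact dist_eq_zero.1 hz

/-- An invariant measure on the fibre product over a topo-isomorphic factor is carried by the
diagonal. -/
theorem IsTopoIsomorphy.ae_fst_eq_snd {T : Type*} [MetricSpace T] [MeasurableSpace T]
    [BorelSpace T] [MulAction G T] {π : X → T} (hπ : IsTopoIsomorphy G π)
    (μ : Measure (X × X)) [IsProbabilityMeasure μ] [SMulInvariantMeasure G (X × X) μ]
    (h : ∀ᵐ z ∂μ, π z.1 = π z.2) : ∀ᵐ z ∂μ, z.1 = z.2 := by
  -- The mean of the two marginals yields one set `M`, with `π` injective on it, that has full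
  -- measure for both coordinates at once.
  let ν : Measure X := (2⁻¹ : ENNReal) • (μ.map Prod.fst + μ.map Prod.snd)
  have h1 : IsProbabilityMeasure (μ.map Prod.fst) :=
    Measure.isProbabilityMeasure_map measurable_fst.aemeasurable
  have h2 : IsProbabilityMeasure (μ.map Prod.snd) :=
    Measure.isProbabilityMeasure_map measurable_snd.aemeasurable
  have hν : IsProbabilityMeasure ν := ⟨by
    simp only [ν, Measure.smul_apply, Measure.add_apply, measure_univ, smul_eq_mul]
    rw [one_add_one_eq_two, ENNReal.inv_mul_cancel two_ne_zero ENNReal.ofNat_ne_top]⟩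
  have hνinv : SMulInvariantMeasure G X ν := ⟨fun g s hs => by
    have hg : MeasurableSet ((fun x => g • x) ⁻¹' s) :=
      (continuous_const_smul g).measurable hs
    simp only [ν, Measure.smul_apply, Measure.add_apply, Measure.map_apply measurable_fst hs,
      Measure.map_apply measurable_snd hs, Measure.map_apply measurable_fst hg,
      Measure.map_apply measurable_snd hg]
    congr 2
    · exact SMulInvariantMeasure.measure_preimage_smul g (measurable_fst hs)
    · exact SMulInvariantMeasure.measure_preimage_smul g (measurable_snd hs)⟩
  obtain ⟨-, M, N, hM, -, hνM, -, e, -, he⟩ := hπ.2 ν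
  have hinj : ∀ x ∈ M, ∀ y ∈ M, π x = π y → x = y := fun x hx y hy hxy => by
    have := (he ⟨x, hx⟩).symm.trans (hxy.trans (he ⟨y, hy⟩))
    exact congrArg Subtype.val (e.injective (Subtype.ext this))
  have hae : ∀ᵐ x ∂ν, x ∈ M := (prob_compl_eq_zero_iff hM).2 hνM
  have hae' : ∀ᵐ x ∂(μ.map Prod.fst + μ.map Prod.snd), x ∈ M :=
    (Measure.ae_ennreal_smul_measure_iff (by simp)).1 hae
  rw [ae_add_measure_iff] at hae'
  filter_upwards [h, ae_of_ae_map measurable_fst.aemeasurable hae'.1,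
    ae_of_ae_map measurable_snd.aemeasurable hae'.2] with z hz hz1 hz2
  exact hinj _ hz1 _ hz2 hz

theorem IsTopoIsomorphy.isWeylMeanEquicontinuous (hG : IsAmenableGroup m)
    {T : Type*} [MetricSpace T] [MeasurableSpace T] [BorelSpace T] [MulAction G T] {π : X → T}
    (hT : IsEquicontinuousAction G T) (hπ : IsTopoIsomorphy G π) :
    IsWeylMeanEquicontinuous m X := by
  by_contra hX
  obtain ⟨μ, _, _, hpos, h⟩ := exists_measure_of_not_isWeylMeanEquicontinuous hG hπ.1 hT hX
  refine hpos.ne' (integral_eq_zero_of_ae ?_)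
  filter_upwards [hπ.ae_fst_eq_snd μ h] with z hz
  simp [hz]

end Pairs

/-! ### Measures on pairs at Weyl distance zero -/

section Diagonal

variable {G : Type*} [Group G] [TopologicalSpace G] [IsTopologicalGroup G] [T2Space G]
  [MeasurableSpace G] [BorelSpace G] {m : Measure G} [IsFiniteMeasureOnCompacts m]
  {X : Type*} [MetricSpace X] [CompactSpace X] [MeasurableSpace X] [BorelSpace X]
  [MulAction G X] [ContinuousSMul G X]

/-- An invariant measure on pairs at Weyl distance zero is carried by the diagonal. -/
theorem ae_fst_eq_snd_of_ae_weylDist_eq_zero (hG : IsAmenableGroup m)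
    (μ : Measure (X × X)) [IsProbabilityMeasure μ] [SMulInvariantMeasure G (X × X) μ]
    (h : ∀ᵐ z ∂μ, weylDist m z.1 z.2 = 0) : ∀ᵐ z ∂μ, z.1 = z.2 := by
  obtain ⟨F, hF⟩ := hG
  have hP := hF.isProbabilityMeasure_cond
  have hc : Continuous fun p : (X × X) × G => dist (p.2 • p.1.1) (p.2 • p.1.2) := by fun_prop
  let f : X × X →ᵇ ℝ := BoundedContinuousFunction.mkOfCompact
    ⟨fun z : X × X => dist z.1 z.2, by fun_prop⟩
  have hf : ∀ z, f z = dist z.1 z.2 := fun z => rfl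
  -- By Fubini and invariance of `μ`, averaging over `F n` leaves the integral of the metric
  -- unchanged; dominated convergence below sends the same quantity to `0`.
  have hconst : ∀ n, ∫ z, ⨍ t in F n, dist (t • z.1) (t • z.2) ∂m ∂μ = ∫ z, f z ∂μ := by
    intro n
    simp only [setAverage_eq_integral_cond]
    rw [integral_integral_swap]
    · have : ∀ t : G, ∫ z : X × X, dist (t • z.1) (t • z.2) ∂μ = ∫ z, f z ∂μ := fun t =>
        integral_smul_eq_of_smulInvariantMeasure μ t f
      simp [this]
    · exact Integrable.of_bound hc.aestronglyMeasurable
        (Metric.diam (Set.univ : Set X)) (ae_of_all _ fun p => by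
          rw [Function.uncurry, Real.norm_of_nonneg dist_nonneg]; exact dist_le_diam_univ _ _)
  have hlim : Tendsto (fun n => ∫ z, ⨍ t in F n, dist (t • z.1) (t • z.2) ∂m ∂μ) atTop
      (𝓝 (∫ z : X × X, (0 : ℝ) ∂μ)) := by
    refine tendsto_integral_of_dominated_convergence
      (fun _ => Metric.diam (Set.univ : Set X)) (fun n => ?_) (integrable_const _)
      (fun n => ae_of_all _ fun z => ?_) ?_
    · simp only [setAverage_eq_integral_cond]
      exact (hc.stronglyMeasurable.integral_prod_right'
        (ν := ProbabilityTheory.cond m (F n))).aestronglyMeasurable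
    · rw [Real.norm_of_nonneg (setAverage_dist_nonneg m (F n) _ _)]
      exact hF.setAverage_dist_le_diam _ _ n
    · filter_upwards [h] with z hz
      exact hF.tendsto_setAverage_dist hz
  simp only [hconst, integral_zero] at hlim
  have h0 : ∫ z, f z ∂μ = 0 := tendsto_nhds_unique tendsto_const_nhds hlim
  have hz := (integral_eq_zero_iff_of_nonneg (μ := μ) (fun z => by rw [hf]; exact dist_nonneg)
    (f.integrable μ)).1 h0
  filter_upwards [hz] with z hz
  exact dist_eq_zero.1 hz

end Diagonal

theorem MeasureTheory.MeasurePreserving.map_of_semiconj {X T : Type*} [MeasurableSpace X]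
    [MeasurableSpace T] {μ : Measure X} {π : X → T} {e : X → X} {s : T → T}
    (hμ : MeasurePreserving e μ μ) (hπ : Measurable π) (hs : Measurable s)
    (hes : ∀ x, π (e x) = s (π x)) : MeasurePreserving s (μ.map π) (μ.map π) := by
  refine ⟨hs, ?_⟩
  have : s ∘ π = π ∘ e := funext fun x => (hes x).symm
  rw [Measure.map_map hs hπ, this, ← Measure.map_map hπ hμ.measurable, hμ.map_eq]

/-! ### Disintegration and the relatively independent self-joining -/

section Disintegration

open ProbabilityTheory

variable {X T : Type*} [MeasurableSpace X] [MeasurableSpace T] [StandardBorelSpace X] [Nonempty X]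
  {μ : Measure X} [IsProbabilityMeasure μ] {π : X → T}

/-- The disintegration of `μ` over the fibres of `π`. -/
noncomputable def fibreKernel (μ : Measure X) [IsProbabilityMeasure μ] (π : X → T) : Kernel T X :=
  (μ.map fun x => (π x, x)).condKernel

instance : IsMarkovKernel (fibreKernel μ π) := by
  unfold fibreKernel; infer_instance

theorem compProd_fibreKernel (μ : Measure X) [IsProbabilityMeasure μ] (π : X → T) :
    μ.map π ⊗ₘ fibreKernel μ π = μ.map fun x => (π x, x) := by
  rw [← Measure.fst_map_prodMk measurable_id']
  exact Measure.disintegrate _ (Measure.condKernel _)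

/-- The disintegrated measure is the image of `μ` on the graph of `π`, which is carried by the pairs
`(π x, x)`. -/
theorem ae_fibreKernel_eq [MeasurableEq T] (hπ : Measurable π) :
    ∀ᵐ t ∂(μ.map π), ∀ᵐ x ∂(fibreKernel μ π t), π x = t := by
  have hms : MeasurableSet {p : T × X | π p.2 = p.1} :=
    measurableSet_eq_fun (hπ.comp measurable_snd) measurable_fst
  have h : ∀ᵐ p ∂(μ.map π ⊗ₘ fibreKernel μ π), π p.2 = p.1 := by
    rw [compProd_fibreKernel μ π, ae_map_iff (hπ.prodMk measurable_id').aemeasurable hms]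
    exact ae_of_all _ fun x => rfl
  exact Measure.ae_ae_of_ae_compProd h

/-- Uniqueness of the disintegration: a symmetry `(e, s)` of `π` and `μ` permutes the fibre
measures. -/
theorem ae_map_comap_fibreKernel (hπ : Measurable π) (e : X ≃ᵐ X) (s : T ≃ᵐ T)
    (hμ : MeasurePreserving e μ μ) (hes : ∀ x, π (e x) = s (π x)) :
    ∀ᵐ t ∂(μ.map π), (fibreKernel μ π (s.symm t)).map e = fibreKernel μ π t := by
  have hs := hμ.map_of_semiconj hπ s.measurable hes
  let κ : Kernel T X := ((fibreKernel μ π).comap s.symm s.symm.measurable).map e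
  have hκ : ∀ t, κ t = (fibreKernel μ π (s.symm t)).map e := fun t => by
    rw [Kernel.map_apply _ e.measurable, Kernel.comap_apply]
  have : IsMarkovKernel κ := Kernel.IsMarkovKernel.map _ e.measurable
  have hg : Measurable fun x => (π x, x) := hπ.prodMk measurable_id
  -- The transported kernel `κ` disintegrates the same measure, since `(s, e)` preserves the image
  -- of `μ` on the graph; uniqueness then identifies it with `fibreKernel μ π` almost everywhere.
  have key : (μ.map fun x => (π x, x)) = (μ.map fun x => (π x, x)).fst ⊗ₘ κ := by
    rw [Measure.fst_map_prodMk measurable_id']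
    ext S hS
    have hS' : MeasurableSet ((fun p : T × X => (s p.1, e p.2)) ⁻¹' S) :=
      (s.measurable.comp measurable_fst).prodMk (e.measurable.comp measurable_snd) hS
    rw [Measure.compProd_apply hS,
      ← hs.lintegral_comp (Kernel.measurable_kernel_prodMk_left hS)]
    have h1 : ∀ t, κ (s t) (Prod.mk (s t) ⁻¹' S) = fibreKernel μ π t
        (Prod.mk t ⁻¹' ((fun p : T × X => (s p.1, e p.2)) ⁻¹' S)) := fun t => by
      rw [hκ, s.symm_apply_apply, Measure.map_apply e.measurable (measurable_prodMk_left hS)]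
      rfl
    simp only [h1]
    rw [← Measure.compProd_apply hS', compProd_fibreKernel μ π, Measure.map_apply hg hS,
      Measure.map_apply hg hS', ← hμ.measure_preimage (hg hS).nullMeasurableSet]
    congr 1
    ext x
    simp [hes]
  have := eq_condKernel_of_measure_eq_compProd κ key
  rw [Measure.fst_map_prodMk measurable_id'] at this
  filter_upwards [this] with t ht
  rw [← hκ, ht]
  rfl

/-- The relatively independent self-joining of `μ` over `π`. -/
noncomputable def relativeJoining (μ : Measure X) [IsProbabilityMeasure μ] (π : X → T) :
    Measure (X × X) :=
  (μ.map π).bind (fibreKernel μ π ×ₖ fibreKernel μ π)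

theorem isProbabilityMeasure_relativeJoining (hπ : Measurable π) :
    IsProbabilityMeasure (relativeJoining μ π) := by
  have := Measure.isProbabilityMeasure_map (μ := μ) hπ.aemeasurable
  unfold relativeJoining
  infer_instance

theorem relativeJoining_apply {S : Set (X × X)} (hS : MeasurableSet S) :
    relativeJoining μ π S =
      ∫⁻ t, (fibreKernel μ π t).prod (fibreKernel μ π t) S ∂(μ.map π) := by
  rw [relativeJoining, Measure.bind_apply hS (Kernel.aemeasurable _)]
  simp only [Kernel.prod_apply]

theorem ae_relativeJoining_iff {p : X × X → Prop} (hp : MeasurableSet {z | p z}) :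
    (∀ᵐ z ∂(relativeJoining μ π), p z) ↔
      ∀ᵐ t ∂(μ.map π), ∀ᵐ x ∂(fibreKernel μ π t), ∀ᵐ y ∂(fibreKernel μ π t), p (x, y) := by
  have hm : Measurable fun t => (fibreKernel μ π t).prod (fibreKernel μ π t) {z | p z}ᶜ := by
    have := (fibreKernel μ π ×ₖ fibreKernel μ π).measurable_coe hp.compl
    simpa only [Kernel.prod_apply] using this
  have h : (∀ᵐ z ∂(relativeJoining μ π), p z) ↔ relativeJoining μ π {z | p z}ᶜ = 0 := Iff.rfl
  rw [h, relativeJoining_apply hp.compl, lintegral_eq_zero_iff hm]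
  refine eventually_congr (.of_forall fun t => ?_)
  rw [← Measure.ae_prod_iff_ae_ae hp]
  rfl

/-- The symmetry permutes the fibre measures, hence their squares, and preserves the base measure
`μ.map π`. -/
theorem relativeJoining_preimage (hπ : Measurable π) (e : X ≃ᵐ X) (s : T ≃ᵐ T)
    (hμ : MeasurePreserving e μ μ) (hes : ∀ x, π (e x) = s (π x)) {S : Set (X × X)}
    (hS : MeasurableSet S) :
    relativeJoining μ π (Prod.map e e ⁻¹' S) = relativeJoining μ π S := by
  have hs := hμ.map_of_semiconj hπ s.measurable hes
  have hm : Measurable fun t => (fibreKernel μ π t).prod (fibreKernel μ π t) S := by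
    have := (fibreKernel μ π ×ₖ fibreKernel μ π).measurable_coe hS
    simpa only [Kernel.prod_apply] using this
  have hee : Measurable (Prod.map e e) := e.measurable.prodMap e.measurable
  rw [relativeJoining_apply hS, relativeJoining_apply (hee hS), ← hs.lintegral_comp hm]
  refine lintegral_congr_ae ?_
  filter_upwards [hs.quasiMeasurePreserving.ae (ae_map_comap_fibreKernel hπ e s hμ hes)] with t ht
  rw [← ht, s.symm_apply_apply, Measure.map_prod_map _ _ e.measurable e.measurable,
    Measure.map_apply hee hS]

/-- If the relatively independent self-joining is carried by the diagonal, then `π` is injective on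
a set of full measure. -/
theorem exists_injOn_of_ae_relativeJoining (hπ : Measurable π) (h : ∀ᵐ z ∂(relativeJoining μ π), z.1 = z.2) :
    ∃ M : Set X, MeasurableSet M ∧ μ M = 1 ∧ Set.InjOn π M := by
  have hdiag : MeasurableSet {z : X × X | z.1 = z.2} :=
    measurableSet_eq_fun measurable_fst measurable_snd
  rw [ae_relativeJoining_iff hdiag] at h
  -- The singleton is a section of a diagonal set, so measurability of kernels on sections applies.
  have hmeas : Measurable fun p : T × X => fibreKernel μ π p.1 {p.2} := by
    have h1 : MeasurableSet {q : (T × X) × X | q.1.2 = q.2} :=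
      measurableSet_eq_fun (measurable_snd.comp measurable_fst) measurable_snd
    have h2 := Kernel.measurable_kernel_prodMk_left
      (κ := (fibreKernel μ π).comap (Prod.fst : T × X → T) measurable_fst) h1
    convert h2 using 3 with p
    · exact (Kernel.comap_apply _ _ _).symm
    · ext y
      simp [eq_comm]
  have hms : MeasurableSet {p : T × X | fibreKernel μ π p.1 {p.2} = 1} :=
    hmeas (measurableSet_singleton 1)
  have hg : Measurable fun x => (π x, x) := hπ.prodMk measurable_id
  -- `M` consists of the points carrying all the mass of their own fibre measure. A square carried
  -- by the diagonal forces Dirac fibre measures, so `M` has full measure; two such points in one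
  -- fibre would give total mass `2`.
  refine ⟨(fun x => (π x, x)) ⁻¹' {p | fibreKernel μ π p.1 {p.2} = 1}, hg hms, ?_, ?_⟩
  · have h3 : ∀ᵐ p ∂(μ.map π ⊗ₘ fibreKernel μ π), fibreKernel μ π p.1 {p.2} = 1 := by
      refine Measure.ae_compProd_of_ae_ae hms ?_
      filter_upwards [h] with t ht
      filter_upwards [ht] with x hx
      refine (prob_compl_eq_zero_iff (measurableSet_singleton x)).1 ?_
      exact hx.mono fun y hy => hy.symm
    rw [compProd_fibreKernel μ π, ae_map_iff hg.aemeasurable hms] at h3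
    exact (prob_compl_eq_zero_iff (hg hms)).1 h3
  · intro x hx y hy hxy
    by_contra hne
    have hx : fibreKernel μ π (π x) {x} = 1 := hx
    have hy : fibreKernel μ π (π y) {y} = 1 := hy
    rw [← hxy] at hy
    have h4 : fibreKernel μ π (π x) ({x} ∪ {y}) = 1 + 1 := by
      rw [measure_union (by simpa using hne) (measurableSet_singleton y), hx, hy]
    have h5 := (prob_le_one (μ := fibreKernel μ π (π x)) (s := {x} ∪ {y}))
    rw [h4] at h5
    norm_num at h5

end Disintegration

/-- A measurable map which is injective on a set of full measure is an isomorphism mod 0 onto its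
push-forward. -/
theorem isIsomorphismModZero_of_injOn {X T : Type*} [MeasurableSpace X] [MeasurableSpace T]
    [StandardBorelSpace X] [MeasurableSpace.CountablySeparated T] {μ : Measure X}
    [IsProbabilityMeasure μ] {π : X → T} (hπ : Measurable π) {M : Set X} (hM : MeasurableSet M)
    (hμM : μ M = 1) (hinj : Set.InjOn π M) : IsIsomorphismModZero μ (μ.map π) π := by
  have := hM.standardBorel
  -- Lusin–Souslin: an injective measurable map on a standard Borel space has measurable image and
  -- measurable inverse.
  have he : MeasurableEmbedding (M.domRestrict π) :=
    (hπ.comp measurable_subtype_coe).measurableEmbedding hinj.injective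
  have hN : MeasurableSet (Set.range (M.domRestrict π)) := he.measurableSet_range
  have hae : ∀ᵐ x ∂μ, x ∈ M := (prob_compl_eq_zero_iff hM).2 hμM
  refine ⟨hπ, M, Set.range (M.domRestrict π), hM, hN, hμM, ?_, he.equivRange,
    ⟨he.equivRange.measurable, ?_⟩, fun x => by simp [Set.domRestrict]⟩
  · rw [Measure.map_apply hπ hN]
    refine le_antisymm prob_le_one (hμM ▸ measure_mono fun x hx => ⟨⟨x, hx⟩, rfl⟩)
  · ext A hA
    have hA' : MeasurableSet (Subtype.val '' A) := hN.subtype_image hA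
    rw [Measure.map_apply he.equivRange.measurable hA,
      (MeasurableEmbedding.subtype_coe hM).comap_apply,
      (MeasurableEmbedding.subtype_coe hN).comap_apply, Measure.map_apply hπ hA']
    refine measure_congr ?_
    filter_upwards [hae] with x hx
    refine propext ⟨?_, ?_⟩
    · rintro ⟨y, hy, rfl⟩
      exact ⟨_, hy, by simp [Set.domRestrict]⟩
    · rintro ⟨a, ha, hax⟩
      refine ⟨⟨x, hx⟩, ?_, rfl⟩
      have : he.equivRange ⟨x, hx⟩ = a := Subtype.ext (by simpa [Set.domRestrict] using hax.symm)
      simpa [this] using ha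

/-! ### From Weyl-mean equicontinuity to topo-isomorphy -/

theorem IsWeylMeanEquicontinuous.isTopoIsomorphy
    {G : Type*} [Group G] [TopologicalSpace G] [IsTopologicalGroup G] [T2Space G]
    [LocallyCompactSpace G] [SigmaCompactSpace G] [MeasurableSpace G] [BorelSpace G]
    {m : Measure G} [m.IsHaarMeasure] [m.Regular] (hG : IsAmenableGroup m)
    {X : Type*} [MetricSpace X] [CompactSpace X] [MeasurableSpace X] [BorelSpace X]
    [MulAction G X] [ContinuousSMul G X]
    {T : Type*} [MetricSpace T] [CompactSpace T] [MeasurableSpace T] [BorelSpace T]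
    [MulAction G T] [ContinuousSMul G T]
    {π : X → T} (hπ : IsMaximalEquicontinuousFactor G π) (hX : IsWeylMeanEquicontinuous m X) :
    IsTopoIsomorphy G π := by
  refine ⟨hπ.isFactorMap, fun μ _ _ => ?_⟩
  have hπm : Measurable π := hπ.isFactorMap.continuous.measurable
  have hne : Nonempty X := μ.nonempty_of_neZero
  have hJ := isProbabilityMeasure_relativeJoining (μ := μ) hπm
  have hJinv : SMulInvariantMeasure G (X × X) (relativeJoining μ π) := ⟨fun g S hS =>
    relativeJoining_preimage hπm (Homeomorph.smul g).toMeasurableEquiv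
      (Homeomorph.smul g).toMeasurableEquiv
      ⟨(continuous_const_smul g).measurable, by
        ext s hs
        rw [Measure.map_apply (Homeomorph.smul g).toMeasurableEquiv.measurable hs]
        exact SMulInvariantMeasure.measure_preimage_smul g hs⟩
      (hπ.isFactorMap.map_smul g) hS⟩
  have hfib : ∀ᵐ z ∂(relativeJoining μ π), π z.1 = π z.2 := by
    have hms : MeasurableSet {z : X × X | π z.1 = π z.2} :=
      measurableSet_eq_fun (hπm.comp measurable_fst) (hπm.comp measurable_snd)
    rw [ae_relativeJoining_iff hms]
    filter_upwards [ae_fibreKernel_eq (μ := μ) hπm] with t ht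
    filter_upwards [ht] with x hx
    filter_upwards [ht] with y hy
    rw [hx, hy]
  -- Weyl-mean equicontinuity `hX` is exactly the continuity required of the invariant pseudometric.
  have hD : ∀ᵐ z ∂(relativeJoining μ π), weylDist m z.1 z.2 = 0 := hfib.mono fun z hz =>
    hπ.pseudoDist_eq_zero (weylDist m) (weylDist_self m) (weylDist_comm m) (weylDist_triangle m)
      (weylDist_smul_le m) hX hz
  obtain ⟨M, hM, hμM, hinj⟩ := exists_injOn_of_ae_relativeJoining hπm
    (ae_fst_eq_snd_of_ae_weylDist_eq_zero hG _ hD)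
  exact isIsomorphismModZero_of_injOn hπm hM hμM hinj

theorem theorem1p1
    {G : Type*} [Group G] [TopologicalSpace G] [IsTopologicalGroup G] [T2Space G]
    [LocallyCompactSpace G] [SigmaCompactSpace G] [MeasurableSpace G] [BorelSpace G]
    (m : Measure G) [m.IsHaarMeasure] [m.Regular] (hG : IsAmenableGroup m)
    {X : Type*} [MetricSpace X] [CompactSpace X] [MeasurableSpace X] [BorelSpace X]
    [MulAction G X] [ContinuousSMul G X]
    {T : Type*} [MetricSpace T] [CompactSpace T] [MeasurableSpace T] [BorelSpace T]
    [MulAction G T] [ContinuousSMul G T]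
    (π : X → T) (hπ : IsMaximalEquicontinuousFactor G π) :
    IsWeylMeanEquicontinuous m X ↔ IsTopoIsomorphy G π :=
  ⟨fun hX => hX.isTopoIsomorphy hG hπ, fun h => h.isWeylMeanEquicontinuous hG hπ.isEquicontinuous⟩
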